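/- **Setting.** Let $d\ge 1$ and let $P$ be a probability law of $(X,Y)$ with $X=(X_1,\dots,X_d)\in\mathbb R^d$. In classification $Y\in\{1,\dots,K\}$; in regression $Y\in\mathbb R$ with $\mathbb E Y^2<\infty$. Fix a tree node, at which $X_j$ ranges over an interval $I_j\subseteq\mathbb R$ (of any kind). For a threshold $w$ put $$IG_j(w)=P(X_j\in I_j)H(Y|X_j\in I_j)-P(X_j\in I_j,X_j<w)H(Y|X_j\in I_j,X_j<w)-P(X_j\in I_j,X_j\ge w)H(Y|X_j\in I_j,X_j\ge w),$$ with $H$ the entropy, and define $VG_j(w)$ in the same way with the conditional variance in place of $H$ (terms whose event has probability $0$ are $0$). Let $g_j=\sup_w IG_j(w)$ in classification and $g_j=\sup_w VG_j(w)$ in regression. Let $(1),\dots,(d)$ be any ranking of the attributes with $g_{(1)}\ge\dots\ge g_{(d)}$; attribute $(1)$ is called the most informative one. Put $l_{(j)}=|g_{(1)}-g_{(j)}|/2$. **PV-Tree at this node.** Each of $M$ machines holds $n$ examples; all $Mn$ examples are drawn independently from $P$. Each machine selects the $k$ attributes with the largest gain computed from its own empirical distribution. The locally selected attributes are ranked by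 the number of machines that select them, and the top $2k$ of them form the set $G$. (If there are fewer than $k$, respectively $2k$, attributes to choose from, all are taken.) The output is an attribute of $G$ with the largest gain computed from the empirical distribution of the merged data of all machines. Ties are broken arbitrarily at every step. For constants $c_{(j)}>0$ and functions $\alpha_{(j)}:\mathbb N\to[0,\infty)$ with $\lim_{n\to\infty}\alpha_{(j)}(n)=0$ write $$\delta_{(j)}(n,k)=\alpha_{(j)}(n)+4e^{-c_{(j)}\,n\,l_{(j)}^2},\qquad S=S(n,k)=\sum_{j=k+1}^d\delta_{(j)}(n,k),\qquad B_M(S)=\sum_{m=\lfloor M/2+1\rfloor}^{M}\binom Mm(1-S)^mS^{M-m}.$$ **Theorem.** Both in classification and in regression: 1. There are such $c_{(j)},\alpha_{(j)}$, depending only on $d$, $P$, the node and the ranking (not on $M,n,k$), such that for all $M,n,k\ge0$ with $S\le1$, the most informative attribute $(1)$ is among the globally selected attributes $G$, however ties are broken, with probability at least $B_M(S)$. 2. For every $M$ there are such $c_{(j)},\alpha_{(j)}$, depending only on $M$, $d$, $P$, the node and the ranking (not on $n,k$), such that for all $n\ge0$ and $0\le k<d$ with $S\le1$, the following holds with probability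 at least $B_M(S)$, however ties are broken: $(1)\in G$, and every attribute $j$ that PV-Tree may output satisfies $g_j=g_{(1)}$. -/

import Mathlib

open MeasureTheory ProbabilityTheory Filter Topology
open scoped ENNReal

noncomputable section

namespace PVTree

/-- A labelled example: a vector of `d` real attributes together with a label in `Y`. -/
abbrev Example (d : ℕ) (Y : Type) : Type := (Fin d → ℝ) × Y

/-- The event that attribute `X_j` takes its value in `J`. -/
def attrIn {d : ℕ} {Y : Type} (j : Fin d) (J : Set ℝ) : Set (Example d Y) :=
  {z | z.1 j ∈ J}

/-- Entropy `-∑ p(y) log p(y)` of the label under the law `Q`. -/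
def labelEntropy {d K : ℕ} (Q : Measure (Example d (Fin K))) : ℝ :=
  ∑ y : Fin K, Real.negMulLog (Q.real {z | z.2 = y})

/-- Variance of the label under the law `Q`. -/
def labelVariance {d : ℕ} (Q : Measure (Example d ℝ)) : ℝ :=
  variance (fun z => z.2) Q

/-- `P(A) · Φ(P(· | A))`; the value is `0` if `P(A) = 0`. For `Φ` the label entropy this is
`P(A) H(Y | A)`, for `Φ` the label variance it is `P(A) Var[Y | A]`. -/
def weighted {d : ℕ} {Y : Type} [MeasurableSpace Y]
    (Φ : Measure (Example d Y) → ℝ) (P : Measure (Example d Y)) (A : Set (Example d Y)) : ℝ :=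
  P.real A * Φ (cond P A)

/-- Reduction of the impurity `Φ` when a node, at which `X_j` ranges over the interval `I j`, is
split by attribute `j` at threshold `w` into `X_j < w` and `w ≤ X_j`: the information gain
`IG_j(w)` for `Φ = labelEntropy`, the variance gain `VG_j(w)` for `Φ = labelVariance`. -/
def splitGain {d : ℕ} {Y : Type} [MeasurableSpace Y]
    (Φ : Measure (Example d Y) → ℝ) (I : Fin d → Set ℝ) (P : Measure (Example d Y))
    (j : Fin d) (w : ℝ) : ℝ :=
  weighted Φ P (attrIn j (I j))
    - (weighted Φ P (attrIn j (I j ∩ Set.Iio w)) + weighted Φ P (attrIn j (I j ∩ Set.Ici w)))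

/-- The informativeness of attribute `j`, the largest gain over all thresholds. (A threshold that
does not cut `I j` leaves one side empty and has gain `0`.) -/
def bestGain {d : ℕ} {Y : Type} [MeasurableSpace Y]
    (Φ : Measure (Example d Y) → ℝ) (I : Fin d → Set ℝ) (P : Measure (Example d Y))
    (j : Fin d) : ℝ :=
  ⨆ w : ℝ, splitGain Φ I P j w

/-- The empirical distribution of a finite sample. -/
def empirical {ι Z : Type} [Fintype ι] [MeasurableSpace Z] (s : ι → Z) : Measure Z :=
  (Fintype.card ι : ℝ≥0∞)⁻¹ • ∑ i, Measure.dirac (s i)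

/-- `T` consists of the `k` elements of `A` with the highest scores (of all elements of `A`, if
there are fewer than `k`); ties may be broken in any way. -/
def IsTopSet {ι β : Type} [LE β] (A : Finset ι) (score : ι → β) (k : ℕ) (T : Finset ι) : Prop :=
  T ⊆ A ∧ T.card = min k A.card ∧ ∀ i ∈ T, ∀ j ∈ A, j ∉ T → score j ≤ score i

/-- A possible outcome of the two voting rounds at a node, when machine `m` holds the sample
`s m`: machine `m` selects its top-`k` attributes `T m` by their gain on its own data, and `G` is
the set of the top-`2k` of all locally selected attributes by the number of machines that select
them. -/
structure IsVoting {d M n : ℕ} {Y : Type} [MeasurableSpace Y]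
    (Φ : Measure (Example d Y) → ℝ) (I : Fin d → Set ℝ) (k : ℕ)
    (s : Fin M → Fin n → Example d Y) (T : Fin M → Finset (Fin d)) (G : Finset (Fin d)) :
    Prop where
  localTop : ∀ m, IsTopSet Finset.univ (bestGain Φ I (empirical (s m))) k (T m)
  globalTop : IsTopSet (Finset.univ.biUnion T)
    (fun j => (Finset.univ.filter (fun m => j ∈ T m)).card) (2 * k) G

/-- Best attribute identification: `j` has the largest gain among the attributes in `G`, computed
from the merged data of all machines. -/
def IsOutput {d M n : ℕ} {Y : Type} [MeasurableSpace Y]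
    (Φ : Measure (Example d Y) → ℝ) (I : Fin d → Set ℝ)
    (s : Fin M → Fin n → Example d Y) (G : Finset (Fin d)) (j : Fin d) : Prop :=
  j ∈ G ∧ ∀ i ∈ G,
    bestGain Φ I (empirical (fun p : Fin M × Fin n => s p.1 p.2)) i
      ≤ bestGain Φ I (empirical (fun p : Fin M × Fin n => s p.1 p.2)) j

/-- The samples for which, however ties are broken, the globally selected attributes contain
attribute `a`. -/
def votedEvent {d : ℕ} {Y : Type} [MeasurableSpace Y]
    (Φ : Measure (Example d Y) → ℝ) (I : Fin d → Set ℝ) (M n k : ℕ) (a : Fin d) :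
    Set (Fin M → Fin n → Example d Y) :=
  {s | ∀ T G, IsVoting Φ I k s T G → a ∈ G}

/-- The samples for which, however ties are broken, the globally selected attributes contain
attribute `a` and the attribute that is finally chosen is as informative as `a` under `P`. -/
def outputEvent {d : ℕ} {Y : Type} [MeasurableSpace Y]
    (Φ : Measure (Example d Y) → ℝ) (I : Fin d → Set ℝ) (P : Measure (Example d Y))
    (M n k : ℕ) (a : Fin d) : Set (Fin M → Fin n → Example d Y) :=
  {s | ∀ T G, IsVoting Φ I k s T G →
    a ∈ G ∧ ∀ j, IsOutput Φ I s G j → bestGain Φ I P j = bestGain Φ I P a}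

/-- The law of the data: `M` machines, each with `n` examples, all drawn independently from `P`. -/
def dataLaw {d : ℕ} {Y : Type} [MeasurableSpace Y] (P : Measure (Example d Y)) (M n : ℕ) :
    Measure (Fin M → Fin n → Example d Y) :=
  Measure.pi fun _ => Measure.pi fun _ => P

/-- `l_(r) = |g_(1) - g_(r)| / 2`, where `g_(r) = g (σ r)` and ranks are counted from `0`. -/
def halfGap {d : ℕ} [NeZero d] (g : Fin d → ℝ) (σ : Equiv.Perm (Fin d)) (r : Fin d) : ℝ :=
  |g (σ 0) - g (σ r)| / 2

/-- `∑_{j > k} δ_(j)(n, k)` with `δ_(j)(n, k) = α_(j)(n) + 4 exp(-c_(j) n l_(j)²)`; ranks are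
counted from `0`, so `j > k` reads `k ≤ r`. -/
def failureSum {d : ℕ} (α : Fin d → ℕ → ℝ) (c l : Fin d → ℝ) (n k : ℕ) : ℝ :=
  ∑ r ∈ Finset.univ.filter (fun r : Fin d => k ≤ (r : ℕ)),
    (α r n + 4 * Real.exp (-(c r * n * (l r) ^ 2)))

/-- `∑_{m = ⌊M/2+1⌋}^M C(M,m) (1 - S)^m S^(M-m)`. -/
def majorityTail (M : ℕ) (S : ℝ) : ℝ :=
  ∑ m ∈ Finset.Icc (M / 2 + 1) M, (M.choose m : ℝ) * (1 - S) ^ m * S ^ (M - m)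

end PVTree

end

open PVTree

/-! The weighted impurity of an event `A` is a fixed function of finitely many integrals over `A`:
of `1` and the class indicators for the entropy, of `1`, `Y`, `Y²` for the variance. A
Glivenko–Cantelli theorem with integrable weights (`uniformLaw`) makes the empirical integrals close
to the true ones over all node events at once, with probability tending to one. Impurities depend
continuously on these integrals, uniformly in the event (`ContinuouslyDetermined`), so all empirical
gains are then close to the true ones. As there are finitely many attributes, one fixed precision
ranks every strictly less informative attribute below (1)
(`ContinuouslyDetermined.exists_ranksBelow`). Let `q n` be the probability that a machine's sample
misses this precision.

If `S ≤ 1`, attributes of rank beyond `k` are strictly less informative than (1), since a zero gap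
alone would contribute `4` to `S`. So every good machine selects (1), and counting votes shows that
a majority of good machines forces (1) into `G`. For claim 1 take `α = q`: the failure probability
of a machine is at most `S`, and the number of good machines dominates a binomial variable. The
exponential terms serve only to exclude zero gaps, so `c = 1` will do.

For claim 2 require all machines to be good. The merged integrals are averages of the local ones,
hence equally precise, and the output is right. This has probability at least `(1 - q)^M ≥ 1 - M q`,
whereas `B_M(S) ≤ 1 - S^M`; so `α = (M q)^(1/M)` suffices, and it tends to `0` because `M` is fixed.
-/

namespace PVTree

/-! ### Empirical measures and their integrals -/

section Empirical

variable {ι Z : Type} [Fintype ι] [MeasurableSpace Z]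

/-- The law of `n` independent examples drawn from `P`. -/
noncomputable def sampleLaw (P : Measure Z) (n : ℕ) : Measure (Fin n → Z) :=
  Measure.pi fun _ => P

instance (P : Measure Z) [IsProbabilityMeasure P] (n : ℕ) :
    IsProbabilityMeasure (sampleLaw P n) := by
  unfold sampleLaw; infer_instance

/-- Equality fails for the empty sample, whose empirical measure is `∞ • 0 = 0`. -/
theorem empirical_univ_le_one (s : ι → Z) : empirical s Set.univ ≤ 1 := by
  simp only [empirical, Measure.smul_apply, Measure.coe_finsetSum, Finset.sum_apply,
    measure_univ, Finset.sum_const, Finset.card_univ, nsmul_eq_mul, mul_one, smul_eq_mul]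
  exact ENNReal.inv_mul_le_one _

instance (s : ι → Z) : IsFiniteMeasure (empirical s) :=
  ⟨(empirical_univ_le_one s).trans_lt ENNReal.one_lt_top⟩

theorem integrable_empirical [MeasurableSingletonClass Z] (s : ι → Z) (f : Z → ℝ) :
    Integrable f (empirical s) := by
  rcases isEmpty_or_nonempty ι with h | h
  · simp [empirical]
  · refine Integrable.smul_measure ?_ (by simp)
    exact integrable_finsetSum_measure.2 fun i _ => integrable_dirac (by simp)

theorem integral_empirical [MeasurableSingletonClass Z] (s : ι → Z) (f : Z → ℝ) :
    ∫ z, f z ∂empirical s = (Fintype.card ι : ℝ)⁻¹ * ∑ i, f (s i) := by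
  rw [empirical, integral_smul_measure,
    integral_finsetSum_measure fun i _ => integrable_dirac (by simp)]
  simp

theorem setIntegral_empirical [MeasurableSingletonClass Z] (s : ι → Z) (f : Z → ℝ) {A : Set Z}
    (hA : MeasurableSet A) :
    ∫ z in A, f z ∂empirical s = (Fintype.card ι : ℝ)⁻¹ * ∑ i, A.indicator f (s i) := by
  rw [← integral_indicator hA, integral_empirical]

/-- The empirical distribution of merged samples of equal size is the average of the empirical
distributions. -/
theorem setIntegral_empirical_merged [MeasurableSingletonClass Z] {M n : ℕ}
    (s : Fin M → Fin n → Z) (f : Z → ℝ) {A : Set Z} (hA : MeasurableSet A) :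
    ∫ z in A, f z ∂empirical (fun p : Fin M × Fin n => s p.1 p.2)
      = (M : ℝ)⁻¹ * ∑ m, ∫ z in A, f z ∂empirical (s m) := by
  simp only [setIntegral_empirical _ _ hA, Fintype.sum_prod_type, Fintype.card_prod,
    Fintype.card_fin, ← Finset.mul_sum]
  push_cast
  rw [mul_inv, mul_assoc]

end Empirical

/-! ### Uniform weak law over half-lines -/

section LawOfLargeNumbers

variable {Z : Type} [MeasurableSpace Z]

/-- Transfers the strong law, which lives on one space of infinite sequences, to the laws of finite
samples. -/
theorem measurePreserving_infinitePi_prefix (P : Measure Z) [IsProbabilityMeasure P] (n : ℕ) :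
    MeasurePreserving (fun (ω : ℕ → Z) (i : Fin n) => ω i) (Measure.infinitePi fun _ => P)
      (sampleLaw P n) := by
  refine ⟨by fun_prop, ?_⟩
  have h : iIndepFun (fun (i : ℕ) (ω : ℕ → Z) => ω i) (Measure.infinitePi fun _ => P) :=
    iIndepFun_infinitePi (X := fun _ z => z) fun _ => measurable_id
  have h' := h.precomp (g := fun i : Fin n => (i : ℕ)) Fin.val_injective
  rw [iIndepFun_iff_map_fun_eq_pi_map (f := fun (i : Fin n) (ω : ℕ → Z) => ω i)
    fun i => (measurable_pi_apply (i : ℕ)).aemeasurable] at h'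
  rw [h', sampleLaw]
  congr 1
  funext i
  exact Measure.infinitePi_map_eval _ _

/-- Weak law of large numbers for the empirical integrals of a function over a fixed event. -/
theorem tendsto_sampleLaw_setIntegral [MeasurableSingletonClass Z] (P : Measure Z)
    [IsProbabilityMeasure P] {f : Z → ℝ} (hf : Measurable f) (hfi : Integrable f P)
    {A : Set Z} (hA : MeasurableSet A) {ε : ℝ} (hε : 0 < ε) :
    Tendsto (fun n => sampleLaw P n
      {s | ε ≤ |∫ z in A, f z ∂empirical s - ∫ z in A, f z ∂P|}) atTop (𝓝 0) := by
  set Q : Measure (ℕ → Z) := Measure.infinitePi fun _ => P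
  set h : Z → ℝ := A.indicator f
  have hh : Measurable h := hf.indicator hA
  have hhi : Integrable h P := hfi.indicator hA
  have hpres (i : ℕ) : MeasurePreserving (fun ω : ℕ → Z => ω i) Q P :=
    measurePreserving_eval_infinitePi (fun _ => P) i
  have hind : iIndepFun (fun (i : ℕ) (ω : ℕ → Z) => h (ω i)) Q :=
    iIndepFun_infinitePi (X := fun _ => h) fun _ => hh
  have hae := strong_law_ae_real (μ := Q) (fun i ω => h (ω i))
    ((hpres 0).integrable_comp_of_integrable hhi) (fun i j hij => hind.indepFun hij)
    (fun i => IdentDistrib.comp (u := h)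
      ⟨(hpres i).aemeasurable, (hpres 0).aemeasurable, by rw [(hpres i).map_eq, (hpres 0).map_eq]⟩
      hh)
  have hmean : ∫ ω, h (ω 0) ∂Q = ∫ z in A, f z ∂P := by
    rw [← integral_indicator hA, ← (hpres 0).map_eq,
      integral_map (hpres 0).aemeasurable hh.aestronglyMeasurable]
  rw [hmean] at hae
  have hmeas := tendstoInMeasure_of_tendsto_ae (fun n => Measurable.aestronglyMeasurable
    ((Finset.measurable_fun_sum _ fun i _ => hh.comp (measurable_pi_apply i)).div_const _)) hae
  rw [tendstoInMeasure_iff_norm] at hmeas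
  refine (hmeas ε hε).congr fun n => ?_
  have hset : MeasurableSet
      {s : Fin n → Z | ε ≤ |∫ z in A, f z ∂empirical s - ∫ z in A, f z ∂P|} := by
    simp only [setIntegral_empirical _ _ hA]
    exact measurableSet_le measurable_const (by fun_prop)
  rw [← (measurePreserving_infinitePi_prefix P n).measure_preimage hset.nullMeasurableSet]
  congr 1
  ext ω
  simp only [Set.mem_preimage, Set.mem_ofPred_eq, setIntegral_empirical _ _ hA, Real.norm_eq_abs,
    Fintype.card_fin, div_eq_inv_mul, Finset.sum_range]
  rfl

/-- The events `{X < w}`, with thresholds in the extended reals. -/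
def below {Z : Type} (X : Z → ℝ) (w : EReal) : Set Z := {z | (X z : EReal) < w}

theorem measurableSet_below {X : Z → ℝ} (hX : Measurable X) (w : EReal) :
    MeasurableSet (below X w) :=
  measurableSet_lt hX.coe_real_ereal measurable_const

/-- The empirical integrals of `f` over the events `{X < w}` converge in probability to the true
ones, uniformly in `w`. -/
def UniformLaw (P : Measure Z) (f X : Z → ℝ) : Prop :=
  ∀ ε : ℝ, 0 < ε → Tendsto (fun n => sampleLaw P n
    {x | ∃ w ∈ Set.univ,
      ε < |∫ z in below X w, f z ∂empirical x - ∫ z in below X w, f z ∂P|}) atTop (𝓝 0)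

theorem tendsto_measure_zero_of_subset_union {Ω : ℕ → Type} [∀ n, MeasurableSpace (Ω n)]
    {μ : ∀ n, Measure (Ω n)} {A B C : ∀ n, Set (Ω n)} (h : ∀ n, C n ⊆ A n ∪ B n)
    (hA : Tendsto (fun n => μ n (A n)) atTop (𝓝 0))
    (hB : Tendsto (fun n => μ n (B n)) atTop (𝓝 0)) :
    Tendsto (fun n => μ n (C n)) atTop (𝓝 0) :=
  tendsto_of_tendsto_of_tendsto_of_le_of_le tendsto_const_nhds (by simpa using hA.add hB)
    (fun _ => zero_le) fun n => (measure_mono (h n)).trans (measure_union_le _ _)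

/-- Uniform convergence, at precision `ε`, over thresholds whose events lie between two events
whose integrals differ by less than `ε / 2`. -/
theorem tendsto_of_bracket [MeasurableSingletonClass Z] {P : Measure Z}
    [IsProbabilityMeasure P] {f X : Z → ℝ} (hf : Measurable f) (hfi : Integrable f P)
    (hf0 : 0 ≤ f) {A B : Set Z} (hA : MeasurableSet A) (hB : MeasurableSet B)
    {s : Set EReal} (hs : ∀ w ∈ s, A ⊆ below X w ∧ below X w ⊆ B) {ε : ℝ} (hε : 0 < ε)
    (hAB : ∫ z in B, f z ∂P - ∫ z in A, f z ∂P < ε / 2) :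
    Tendsto (fun n => sampleLaw P n
      {x | ∃ w ∈ s, ε < |∫ z in below X w, f z ∂empirical x - ∫ z in below X w, f z ∂P|})
      atTop (𝓝 0) := by
  refine tendsto_measure_zero_of_subset_union (fun n x hx => ?_)
    (tendsto_sampleLaw_setIntegral P hf hfi hA (half_pos hε))
    (tendsto_sampleLaw_setIntegral P hf hfi hB (half_pos hε))
  obtain ⟨w, hw, hx⟩ := hx
  obtain ⟨h1, h2⟩ := hs w hw
  -- As `f ≥ 0`, the integral over `below X w` is sandwiched under both measures, so its error
  -- exceeds the errors at `A` and `B`, each below `ε / 2`, by at most the width of the bracket.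
  have key (Q : Measure Z) (hQ : Integrable f Q) :
      ∫ z in A, f z ∂Q ≤ ∫ z in below X w, f z ∂Q ∧
      ∫ z in below X w, f z ∂Q ≤ ∫ z in B, f z ∂Q :=
    ⟨setIntegral_mono_set hQ.integrableOn (.of_forall hf0) (LE.le.eventuallyLE h1),
      setIntegral_mono_set hQ.integrableOn (.of_forall hf0) (LE.le.eventuallyLE h2)⟩
  obtain ⟨a1, a2⟩ := key P hfi
  obtain ⟨b1, b2⟩ := key _ (integrable_empirical x f)
  by_contra hcon
  simp only [Set.mem_union, Set.mem_ofPred_eq, not_or, not_le, abs_lt] at hcon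
  obtain ⟨⟨c1, c2⟩, c3, c4⟩ := hcon
  refine absurd hx (not_lt.2 (abs_le.2 ⟨by linarith, by linarith⟩))

theorem tendsto_setIntegral_of_tendsto_indicator {P : Measure Z} {f : Z → ℝ} (hfi : Integrable f P)
    {l : Filter EReal} [l.IsCountablyGenerated] {A : EReal → Set Z} {B : Set Z}
    (hA : ∀ w, MeasurableSet (A w)) (hB : MeasurableSet B)
    (h : ∀ z, ∀ᶠ w in l, z ∈ A w ↔ z ∈ B) :
    Tendsto (fun w => ∫ z in A w, f z ∂P) l (𝓝 (∫ z in B, f z ∂P)) := by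
  simp only [← integral_indicator (hA _), ← integral_indicator hB]
  refine tendsto_integral_filter_of_dominated_convergence (fun z => ‖f z‖)
    (.of_forall fun w => (hfi.indicator (hA w)).aestronglyMeasurable)
    (.of_forall fun w => .of_forall fun z => norm_indicator_le_norm_self _ _) hfi.norm
    (.of_forall fun z => ?_)
  refine tendsto_const_nhds.congr' ?_
  filter_upwards [h z] with w hw
  by_cases hz : z ∈ B
  · rw [Set.indicator_of_mem hz, Set.indicator_of_mem (hw.2 hz)]
  · rw [Set.indicator_of_notMem hz, Set.indicator_of_notMem (fun h => hz (hw.1 h))]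

/-- Compactness of `EReal` replaces the choice of quantiles. Each point `x` has a neighbourhood made
of a left interval, a right interval and `{x}`, each admitting a bracket of small mass; the point is
separate because `X` may have an atom there. -/
theorem uniformLaw_of_nonneg [MeasurableSingletonClass Z] {P : Measure Z}
    [IsProbabilityMeasure P] {f X : Z → ℝ} (hf : Measurable f) (hfi : Integrable f P)
    (hf0 : 0 ≤ f) (hX : Measurable X) : UniformLaw P f X := by
  intro ε hε
  set p : Set EReal → Prop := fun s => Tendsto (fun n => sampleLaw P n
    {x | ∃ w ∈ s, ε < |∫ z in below X w, f z ∂empirical x - ∫ z in below X w, f z ∂P|})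
    atTop (𝓝 0) with hp
  have p_empty : p ∅ := by simp [hp]
  have p_mono : ∀ ⦃s t : Set EReal⦄, s ⊆ t → p t → p s := fun s t hst h =>
    tendsto_of_tendsto_of_tendsto_of_le_of_le tendsto_const_nhds h (fun _ => zero_le)
      fun _ => measure_mono fun _ ⟨w, hw, hx⟩ => ⟨w, hst hw, hx⟩
  have p_union : ∀ ⦃s t : Set EReal⦄, p s → p t → p (s ∪ t) := fun s t hs ht => by
    refine tendsto_measure_zero_of_subset_union (fun n x hx => ?_) hs ht
    obtain ⟨w, hw, hx⟩ := hx
    exact hw.imp (fun h => ⟨w, h, hx⟩) fun h => ⟨w, h, hx⟩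
  refine isCompact_univ.induction_on p_empty p_mono p_union fun x _ => ?_
  rw [nhdsWithin_univ]
  have hatMost : MeasurableSet {z | (X z : EReal) ≤ x} :=
    measurableSet_le hX.coe_real_ereal measurable_const
  have hleft : ∃ t ∈ 𝓝[<] x, p t := by
    rcases eq_or_ne x ⊥ with rfl | hx
    · exact ⟨∅, by simp, p_empty⟩
    have hlim := tendsto_setIntegral_of_tendsto_indicator (l := 𝓝[<] x) (A := below X)
      (B := below X x) hfi (measurableSet_below hX) (measurableSet_below hX x) fun z => by
        rcases lt_or_ge (X z : EReal) x with h | h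
        · filter_upwards [Ioo_mem_nhdsLT h] with w hw
          exact iff_of_true hw.1 h
        · filter_upwards [self_mem_nhdsWithin] with w hw
          exact iff_of_false (not_lt.2 ((le_of_lt hw).trans h)) (not_lt.2 h)
    have hev := hlim.eventually (lt_mem_nhds (sub_lt_self _ (half_pos hε)))
    have : (𝓝[<] x).NeBot := nhdsLT_neBot_of_exists_lt ⟨⊥, bot_lt_iff_ne_bot.2 hx⟩
    obtain ⟨a, ha, hax⟩ := (hev.and self_mem_nhdsWithin).exists
    refine ⟨Set.Ioo a x, Ioo_mem_nhdsLT hax, ?_⟩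
    exact tendsto_of_bracket hf hfi hf0 (measurableSet_below hX a) (measurableSet_below hX x)
      (fun w hw => ⟨fun z hz => lt_trans hz hw.1, fun z hz => lt_trans hz hw.2⟩) hε (by linarith)
  have hright : ∃ t ∈ 𝓝[>] x, p t := by
    rcases eq_or_ne x ⊤ with rfl | hx
    · exact ⟨∅, by simp, p_empty⟩
    have hlim := tendsto_setIntegral_of_tendsto_indicator (l := 𝓝[>] x) (A := below X)
      (B := {z | (X z : EReal) ≤ x}) hfi (measurableSet_below hX) hatMost fun z => by
        rcases lt_or_ge x (X z : EReal) with h | h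
        · filter_upwards [Ioo_mem_nhdsGT h] with w hw
          exact iff_of_false (not_lt.2 hw.2.le) (not_le.2 h)
        · filter_upwards [self_mem_nhdsWithin] with w hw
          exact iff_of_true (h.trans_lt hw) h
    have hev := hlim.eventually (gt_mem_nhds (lt_add_of_pos_right _ (half_pos hε)))
    have : (𝓝[>] x).NeBot := nhdsGT_neBot_of_exists_gt ⟨⊤, lt_top_iff_ne_top.2 hx⟩
    obtain ⟨b, hb, hxb⟩ := (hev.and self_mem_nhdsWithin).exists
    refine ⟨Set.Ioo x b, Ioo_mem_nhdsGT hxb, ?_⟩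
    exact tendsto_of_bracket hf hfi hf0 hatMost (measurableSet_below hX b)
      (fun w hw => ⟨fun z hz => lt_of_le_of_lt hz hw.1, fun z hz => lt_trans hz hw.2⟩) hε
      (by linarith)
  have hpoint : p {x} :=
    tendsto_of_bracket hf hfi hf0 (measurableSet_below hX x) (measurableSet_below hX x)
      (by simp) hε (by simpa using hε)
  obtain ⟨s, hs, hps⟩ := hleft
  obtain ⟨t, ht, hpt⟩ := hright
  refine ⟨(s ∪ t) ∪ {x}, ?_, p_union (p_union hps hpt) hpoint⟩
  rw [← nhdsNE_sup_pure, ← nhdsLT_sup_nhdsGT, mem_sup, mem_sup]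
  exact ⟨⟨mem_of_superset hs fun _ h => .inl (.inl h), mem_of_superset ht fun _ h => .inl (.inr h)⟩,
    by simp⟩

/-- A Glivenko–Cantelli theorem for integrable weights. -/
theorem uniformLaw [MeasurableSingletonClass Z] {P : Measure Z} [IsProbabilityMeasure P]
    {f X : Z → ℝ} (hf : Measurable f) (hfi : Integrable f P)
    (hX : Measurable X) : UniformLaw P f X := by
  intro ε hε
  have hpos := uniformLaw_of_nonneg (f := fun z => max (f z) 0) (hf.max measurable_const)
    hfi.pos_part (fun z => le_max_right _ _) hX
  have hneg := uniformLaw_of_nonneg (f := fun z => max (-f z) 0) (hf.neg.max measurable_const)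
    hfi.neg_part (fun z => le_max_right _ _) hX
  refine tendsto_measure_zero_of_subset_union (fun n x hx => ?_) (hpos _ (half_pos hε))
    (hneg _ (half_pos hε))
  obtain ⟨w, hw, hx⟩ := hx
  have key (Q : Measure Z) (hQ : Integrable f Q) : ∫ z in below X w, f z ∂Q
      = ∫ z in below X w, max (f z) 0 ∂Q - ∫ z in below X w, max (-f z) 0 ∂Q := by
    rw [← integral_sub hQ.pos_part.integrableOn hQ.neg_part.integrableOn]
    congr 1
    funext z
    rcases le_total 0 (f z) with h | h <;> simp [h]
  rw [key P hfi, key _ (integrable_empirical x f)] at hx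
  by_contra hcon
  simp only [Set.mem_union, Set.mem_ofPred_eq, not_or, not_exists, not_and, not_lt] at hcon
  have h1 := abs_le.1 (hcon.1 w hw)
  have h2 := abs_le.1 (hcon.2 w hw)
  exact absurd hx (not_lt.2 (abs_le.2 ⟨by linarith [h1.1, h2.2], by linarith [h1.2, h2.1]⟩))

end LawOfLargeNumbers

/-! ### From uniformly close integrals to the ranking of gains -/

section Gains

variable {d : ℕ} {Y : Type} [MeasurableSpace Y]

/-- The events whose impurity enters the gains at a node. -/
def nodeEvents (Y : Type) (I : Fin d → Set ℝ) : Set (Set (Example d Y)) :=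
  {A | ∃ j, A = attrIn j (I j) ∨
    ∃ w, A = attrIn j (I j ∩ Set.Iio w) ∨ A = attrIn j (I j ∩ Set.Ici w)}

theorem measurableSet_attrIn (j : Fin d) {J : Set ℝ} (hJ : MeasurableSet J) :
    MeasurableSet (attrIn j J : Set (Example d Y)) :=
  ((measurable_pi_apply j).comp measurable_fst) hJ

theorem measurableSet_of_mem_nodeEvents {I : Fin d → Set ℝ} (hI : ∀ j, (I j).OrdConnected)
    {A : Set (Example d Y)} (hA : A ∈ nodeEvents Y I) : MeasurableSet A := by
  obtain ⟨j, rfl | ⟨w, rfl | rfl⟩⟩ := hA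
  · exact measurableSet_attrIn j (hI j).measurableSet
  · exact measurableSet_attrIn j ((hI j).measurableSet.inter measurableSet_Iio)
  · exact measurableSet_attrIn j ((hI j).measurableSet.inter measurableSet_Ici)

/-- The integrals of all `F i` over all node events under `Q` are within `δ` of those under `P`. -/
def NodeClose {κ : Type} (F : κ → Example d Y → ℝ) (I : Fin d → Set ℝ)
    (P : Measure (Example d Y)) (δ : ℝ) (Q : Measure (Example d Y)) : Prop :=
  ∀ i, ∀ A ∈ nodeEvents Y I, |∫ z in A, F i z ∂Q - ∫ z in A, F i z ∂P| ≤ δ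

theorem NodeClose.merged [MeasurableSingletonClass Y] {κ : Type} {F : κ → Example d Y → ℝ}
    {I : Fin d → Set ℝ} (hI : ∀ j, (I j).OrdConnected) {P : Measure (Example d Y)} {δ : ℝ}
    {M n : ℕ} (hM : 0 < M) {s : Fin M → Fin n → Example d Y}
    (hs : ∀ m, NodeClose F I P δ (empirical (s m))) :
    NodeClose F I P δ (empirical fun p : Fin M × Fin n => s p.1 p.2) := by
  intro i A hA
  have hM' : (0 : ℝ) < M := by exact_mod_cast hM
  rw [setIntegral_empirical_merged _ _ (measurableSet_of_mem_nodeEvents hI hA)]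
  have h : (M : ℝ)⁻¹ * ∑ m, ∫ z in A, F i z ∂empirical (s m) - ∫ z in A, F i z ∂P
      = (M : ℝ)⁻¹ * ∑ m, (∫ z in A, F i z ∂empirical (s m) - ∫ z in A, F i z ∂P) := by
    rw [Finset.sum_sub_distrib, Finset.sum_const, Finset.card_univ, Fintype.card_fin, nsmul_eq_mul]
    field_simp
  rw [h, abs_mul, abs_of_pos (inv_pos.2 hM'), inv_mul_le_iff₀ hM']
  calc _ ≤ ∑ m, |∫ z in A, F i z ∂empirical (s m) - ∫ z in A, F i z ∂P| :=
        Finset.abs_sum_le_sum_abs _ _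
    _ ≤ ∑ _m : Fin M, δ := Finset.sum_le_sum fun m _ => hs m i A hA
    _ = M * δ := by simp

/-- Absorbing the node's interval into the weight reduces node events to the half-lines of
`UniformLaw`. -/
theorem setIntegral_below_attrIn {j : Fin d} {J : Set ℝ} (hJ : MeasurableSet J) (w : EReal)
    (Q : Measure (Example d Y)) (f : Example d Y → ℝ) :
    ∫ z in below (fun z : Example d Y => z.1 j) w, (attrIn j J).indicator f z ∂Q
      = ∫ z in attrIn j (J ∩ {t : ℝ | (t : EReal) < w}), f z ∂Q := by
  rw [setIntegral_indicator (measurableSet_attrIn j hJ), Set.inter_comm]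
  rfl

theorem setIntegral_attrIn_Ici {j : Fin d} {J : Set ℝ} (hJ : MeasurableSet J) (w : ℝ)
    {Q : Measure (Example d Y)} {f : Example d Y → ℝ} (hf : Integrable f Q) :
    ∫ z in attrIn j (J ∩ Set.Ici w), f z ∂Q
      = ∫ z in attrIn j J, f z ∂Q - ∫ z in attrIn j (J ∩ Set.Iio w), f z ∂Q := by
  have hset : (attrIn j J : Set (Example d Y))
      = attrIn j (J ∩ Set.Iio w) ∪ attrIn j (J ∩ Set.Ici w) := by
    ext z
    simp only [attrIn, Set.mem_union, Set.mem_ofPred_eq, Set.mem_inter_iff, Set.mem_Iio,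
      Set.mem_Ici, ← and_or_left, lt_or_ge, and_true]
  rw [hset, setIntegral_union _ (measurableSet_attrIn j (hJ.inter measurableSet_Ici))
    hf.integrableOn hf.integrableOn, add_sub_cancel_left]
  rw [Set.disjoint_left]
  rintro z ⟨_, h1⟩ ⟨_, h2⟩
  exact absurd (Set.mem_Iio.1 h1) (not_lt.2 h2)

theorem tendsto_sampleLaw_not_nodeClose [MeasurableSingletonClass Y] {κ : Type} [Fintype κ]
    {F : κ → Example d Y → ℝ} {I : Fin d → Set ℝ} (hI : ∀ j, (I j).OrdConnected)
    {P : Measure (Example d Y)} [IsProbabilityMeasure P] (hF : ∀ i, Measurable (F i))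
    (hFi : ∀ i, Integrable (F i) P) {δ : ℝ} (hδ : 0 < δ) :
    Tendsto (fun n => sampleLaw P n {s | ¬ NodeClose F I P δ (empirical s)}) atTop (𝓝 0) := by
  have hlaw (i : κ) (j : Fin d) := uniformLaw (P := P) (X := fun z : Example d Y => z.1 j)
    ((hF i).indicator (measurableSet_attrIn j (hI j).measurableSet))
    ((hFi i).indicator (measurableSet_attrIn j (hI j).measurableSet))
    ((measurable_pi_apply j).comp measurable_fst) (δ / 2) (half_pos hδ)
  have hsum := tendsto_finsetSum Finset.univ fun i _ => tendsto_finsetSum Finset.univ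
    fun j _ => hlaw i j
  simp only [Finset.sum_const_zero] at hsum
  refine tendsto_of_tendsto_of_tendsto_of_le_of_le tendsto_const_nhds hsum (fun _ => zero_le)
    fun n => ?_
  refine (measure_mono ?_).trans ((measure_iUnion_fintype_le _ _).trans
    (Finset.sum_le_sum fun i _ => measure_iUnion_fintype_le _ _))
  intro s hs
  by_contra hcon
  simp only [Set.mem_iUnion, Set.mem_ofPred_eq, not_exists, not_and, not_lt, Set.mem_univ,
    true_imp_iff, setIntegral_below_attrIn (hI _).measurableSet] at hcon
  refine hs fun i A hA => ?_
  obtain ⟨j, hA⟩ := hA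
  -- The threshold `⊤` gives the uncut node. Right halves are differences of the whole and a left
  -- half, which is why the precision was `δ / 2`.
  have hwhole := hcon i j ⊤
  have hleft (w : ℝ) := hcon i j w
  have h1 : {t : ℝ | (t : EReal) < ⊤} = Set.univ := by ext; simp
  have h2 (w : ℝ) : {t : ℝ | (t : EReal) < w} = Set.Iio w := by ext; simp
  simp only [h1, Set.inter_univ] at hwhole
  simp only [h2] at hleft
  obtain rfl | ⟨w, rfl | rfl⟩ := hA
  · linarith
  · linarith [hleft w]
  · rw [setIntegral_attrIn_Ici (hI j).measurableSet w (integrable_empirical s _),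
      setIntegral_attrIn_Ici (hI j).measurableSet w (hFi i)]
    have a1 := abs_le.1 hwhole
    have a2 := abs_le.1 (hleft w)
    exact abs_le.2 ⟨by linarith [a1.1, a2.2], by linarith [a1.2, a2.1]⟩

/-- A gain has three impurity terms, and suprema preserve uniform bounds. Nonnegativity bounds the
gains by the impurity of the node, so the real suprema are genuine. -/
theorem abs_bestGain_sub_le {Φ : Measure (Example d Y) → ℝ} (hΦ : ∀ Q A, 0 ≤ weighted Φ Q A)
    {I : Fin d → Set ℝ} {P Q : Measure (Example d Y)} {ε : ℝ}
    (h : ∀ A ∈ nodeEvents Y I, |weighted Φ Q A - weighted Φ P A| ≤ ε) (j : Fin d) :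
    |bestGain Φ I Q j - bestGain Φ I P j| ≤ 3 * ε := by
  have hbdd (R : Measure (Example d Y)) : BddAbove (Set.range (splitGain Φ I R j)) := by
    refine ⟨weighted Φ R (attrIn j (I j)), ?_⟩
    rintro _ ⟨w, rfl⟩
    have := hΦ R (attrIn j (I j ∩ Set.Iio w))
    have := hΦ R (attrIn j (I j ∩ Set.Ici w))
    simp only [splitGain]
    linarith
  have hsplit (w : ℝ) : |splitGain Φ I Q j w - splitGain Φ I P j w| ≤ 3 * ε := by
    have h1 := abs_le.1 (h _ ⟨j, .inl rfl⟩)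
    have h2 := abs_le.1 (h _ ⟨j, .inr ⟨w, .inl rfl⟩⟩)
    have h3 := abs_le.1 (h _ ⟨j, .inr ⟨w, .inr rfl⟩⟩)
    simp only [splitGain]
    exact abs_le.2 ⟨by linarith [h1.1, h2.2, h3.2], by linarith [h1.2, h2.1, h3.1]⟩
  have h1 : bestGain Φ I Q j ≤ bestGain Φ I P j + 3 * ε := ciSup_le fun w => by
    have := le_ciSup (hbdd P) w
    have := (abs_le.1 (hsplit w)).2
    simp only [bestGain]
    linarith
  have h2 : bestGain Φ I P j ≤ bestGain Φ I Q j + 3 * ε := ciSup_le fun w => by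
    have := le_ciSup (hbdd Q) w
    have := (abs_le.1 (hsplit w)).1
    simp only [bestGain]
    linarith
  exact abs_le.2 ⟨by linarith, by linarith⟩

/-- `Q` ranks every attribute that is less informative than `a` under `P` below `a`. -/
def RanksBelow (Φ : Measure (Example d Y) → ℝ) (I : Fin d → Set ℝ) (P : Measure (Example d Y))
    (a : Fin d) (Q : Measure (Example d Y)) : Prop :=
  ∀ j, bestGain Φ I P j < bestGain Φ I P a → bestGain Φ I Q j < bestGain Φ I Q a

/-- The weighted impurities of the node events are determined continuously by the integrals of
the functions `F i`. -/
def ContinuouslyDetermined {κ : Type} (Φ : Measure (Example d Y) → ℝ)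
    (F : κ → Example d Y → ℝ) (I : Fin d → Set ℝ) (P : Measure (Example d Y)) : Prop :=
  ∀ ε : ℝ, 0 < ε → ∃ δ : ℝ, 0 < δ ∧ ∀ Q : Measure (Example d Y), Q Set.univ ≤ 1 →
    (∀ i, Integrable (F i) Q) → NodeClose F I P δ Q →
      ∀ A ∈ nodeEvents Y I, |weighted Φ Q A - weighted Φ P A| ≤ ε

theorem ContinuouslyDetermined.exists_ranksBelow {κ : Type} {Φ : Measure (Example d Y) → ℝ}
    {F : κ → Example d Y → ℝ} {I : Fin d → Set ℝ} {P : Measure (Example d Y)}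
    (hc : ContinuouslyDetermined Φ F I P) (hΦ : ∀ Q A, 0 ≤ weighted Φ Q A) (a : Fin d) :
    ∃ δ : ℝ, 0 < δ ∧ ∀ Q : Measure (Example d Y), Q Set.univ ≤ 1 →
      (∀ i, Integrable (F i) Q) → NodeClose F I P δ Q → RanksBelow Φ I P a Q := by
  obtain ⟨γ, hγ, hgap⟩ : ∃ γ : ℝ, 0 < γ ∧ ∀ j, bestGain Φ I P j < bestGain Φ I P a →
      γ < bestGain Φ I P a - bestGain Φ I P j := by
    have (j : Fin d) : ∀ᶠ γ : ℝ in 𝓝[>] 0, bestGain Φ I P j < bestGain Φ I P a →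
        γ < bestGain Φ I P a - bestGain Φ I P j := by
      by_cases hj : bestGain Φ I P j < bestGain Φ I P a
      · filter_upwards [Ioo_mem_nhdsGT (sub_pos.2 hj)] with γ hγ _ using hγ.2
      · exact .of_forall fun _ h => absurd h hj
    obtain ⟨γ, h1, h2⟩ := ((eventually_all.2 this).and self_mem_nhdsWithin).exists
    exact ⟨γ, h2, h1⟩
  -- Each gain then moves by at most `3 * (γ / 12) = γ / 4`, so a gap larger than `γ` stays
  -- positive.
  obtain ⟨δ, hδ, h⟩ := hc (γ / 12) (by positivity)
  refine ⟨δ, hδ, fun Q hQ hQi hQc j hj => ?_⟩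
  have hb := abs_bestGain_sub_le hΦ (h Q hQ hQi hQc)
  have h1 := abs_le.1 (hb j)
  have h2 := abs_le.1 (hb a)
  linarith [h1.2, h2.1, hgap j hj]

end Gains

/-! ### Entropy and variance as continuous functions of integrals -/

section Impurities

variable {d : ℕ}

theorem weighted_labelEntropy_nonneg {K : ℕ} (Q : Measure (Example d (Fin K)))
    (A : Set (Example d (Fin K))) : 0 ≤ weighted labelEntropy Q A :=
  mul_nonneg measureReal_nonneg <| Finset.sum_nonneg fun _ _ =>
    Real.negMulLog_nonneg measureReal_nonneg measureReal_le_one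

theorem weighted_labelVariance_nonneg (Q : Measure (Example d ℝ)) (A : Set (Example d ℝ)) :
    0 ≤ weighted labelVariance Q A :=
  mul_nonneg measureReal_nonneg (variance_nonneg _ _)

/-- The constant `1` and the indicators of the label classes. -/
noncomputable def classIndicators (d K : ℕ) : Option (Fin K) → Example d (Fin K) → ℝ
  | none => fun _ => 1
  | some y => {z | z.2 = y}.indicator fun _ => 1

theorem measurableSet_label {K : ℕ} (y : Fin K) :
    MeasurableSet {z : Example d (Fin K) | z.2 = y} :=
  measurable_snd (measurableSet_singleton y)

theorem measurable_classIndicators {K : ℕ} (i : Option (Fin K)) :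
    Measurable (classIndicators d K i) := by
  cases i with
  | none => exact measurable_const
  | some y => exact measurable_const.indicator (measurableSet_label y)

theorem integrable_classIndicators {K : ℕ} (i : Option (Fin K))
    (Q : Measure (Example d (Fin K))) [IsFiniteMeasure Q] :
    Integrable (classIndicators d K i) Q := by
  cases i with
  | none => exact integrable_const _
  | some y => exact (integrable_const _).indicator (measurableSet_label y)

theorem setIntegral_classIndicators_none {K : ℕ} (Q : Measure (Example d (Fin K)))
    (A : Set (Example d (Fin K))) :
    ∫ z in A, classIndicators d K none z ∂Q = Q.real A := by
  simp [classIndicators]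

theorem setIntegral_classIndicators_some {K : ℕ} (Q : Measure (Example d (Fin K)))
    (A : Set (Example d (Fin K))) (y : Fin K) :
    ∫ z in A, classIndicators d K (some y) z ∂Q = Q.real (A ∩ {z | z.2 = y}) := by
  simp [classIndicators, integral_indicator (measurableSet_label y),
    Measure.restrict_restrict (measurableSet_label y), Set.inter_comm]

theorem sum_measureReal_label {K : ℕ} (Q : Measure (Example d (Fin K))) [IsFiniteMeasure Q]
    {A : Set (Example d (Fin K))} (hA : MeasurableSet A) :
    ∑ y, Q.real (A ∩ {z | z.2 = y}) = Q.real A := by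
  rw [← measureReal_iUnion_fintype]
  · congr 1
    ext z
    simp
  · intro y y' hyy'
    exact Set.disjoint_left.2 fun z h h' => hyy' (h.2.symm.trans h'.2)
  · exact fun y => hA.inter (measurableSet_label y)

/-- The factor `Q(A)` cancels the normalisation of the conditional law; the result is continuous
even at events of mass zero. -/
theorem weighted_labelEntropy_eq {K : ℕ} (Q : Measure (Example d (Fin K))) [IsFiniteMeasure Q]
    {A : Set (Example d (Fin K))} (hA : MeasurableSet A) :
    weighted labelEntropy Q A
      = ∑ y, Real.negMulLog (∫ z in A, classIndicators d K (some y) z ∂Q)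
        - Real.negMulLog (∫ z in A, classIndicators d K none z ∂Q) := by
  have hcond (B : Set (Example d (Fin K))) :
      (ProbabilityTheory.cond Q A).real B = (Q.real A)⁻¹ * Q.real (A ∩ B) := by
    simp [Measure.real, cond_apply hA]
  simp only [setIntegral_classIndicators_none, setIntegral_classIndicators_some, weighted,
    labelEntropy, hcond]
  rcases eq_or_ne (Q.real A) 0 with h0 | h0
  · have (y : Fin K) : Q.real (A ∩ {z | z.2 = y}) = 0 :=
      le_antisymm ((measureReal_mono Set.inter_subset_left).trans h0.le) measureReal_nonneg
    simp [h0, this]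
  · rw [Finset.mul_sum]
    have (y : Fin K) :
        Q.real A * Real.negMulLog ((Q.real A)⁻¹ * Q.real (A ∩ {z | z.2 = y}))
          = Real.negMulLog (Q.real (A ∩ {z | z.2 = y}))
            + Q.real (A ∩ {z | z.2 = y}) * Real.log (Q.real A) := by
      rw [Real.negMulLog_mul]
      simp only [Real.negMulLog, Real.log_inv]
      field_simp
      ring
    rw [Finset.sum_congr rfl fun y _ => this y, Finset.sum_add_distrib, ← Finset.sum_mul,
      sum_measureReal_label Q hA, Real.negMulLog.eq_1 (Q.real A)]
    ring

/-- The integrals always lie in a unit cube, where the continuous formula for the entropy is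
uniformly continuous by compactness. -/
theorem continuouslyDetermined_labelEntropy {K : ℕ} {I : Fin d → Set ℝ}
    (hI : ∀ j, (I j).OrdConnected) (P : Measure (Example d (Fin K))) [IsProbabilityMeasure P] :
    ContinuouslyDetermined labelEntropy (classIndicators d K) I P := by
  intro ε hε
  set Ψ : (Option (Fin K) → ℝ) → ℝ := fun v =>
    ∑ y, Real.negMulLog (v (some y)) - Real.negMulLog (v none) with hΨ
  have hcont : Continuous Ψ := by fun_prop
  have huc : UniformContinuousOn Ψ (Set.Icc 0 1) :=
    isCompact_Icc.uniformContinuousOn_of_continuous hcont.continuousOn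
  obtain ⟨δ, hδ, h⟩ := Metric.uniformContinuousOn_iff.1 huc ε hε
  refine ⟨δ / 2, half_pos hδ, fun Q hQ _ hc A hA => ?_⟩
  have : IsFiniteMeasure Q := ⟨hQ.trans_lt ENNReal.one_lt_top⟩
  have hAm := measurableSet_of_mem_nodeEvents hI hA
  have hmem (μ : Measure (Example d (Fin K))) (hμ : μ Set.univ ≤ 1) :
      (fun i => ∫ z in A, classIndicators d K i z ∂μ) ∈ Set.Icc (0 : Option (Fin K) → ℝ) 1 := by
    have hle (B : Set (Example d (Fin K))) : μ.real B ≤ 1 :=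
      ENNReal.toReal_le_of_le_ofReal zero_le_one
        (by simpa using (measure_mono (Set.subset_univ B)).trans hμ)
    constructor <;> intro i <;> cases i <;>
      simp only [setIntegral_classIndicators_none, setIntegral_classIndicators_some,
        Pi.zero_apply, Pi.one_apply, measureReal_nonneg, hle]
  have := h _ (hmem Q hQ) _ (hmem P measure_univ.le) (by
    refine (dist_pi_lt_iff hδ).2 fun i => ?_
    rw [Real.dist_eq]
    exact (hc i A hA).trans_lt (half_lt_self hδ))
  rw [weighted_labelEntropy_eq Q hAm, weighted_labelEntropy_eq P hAm]
  rw [Real.dist_eq] at this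
  exact this.le

/-- The first powers of the label. -/
def labelPowers (d : ℕ) : Fin 3 → Example d ℝ → ℝ := fun i z => z.2 ^ (i : ℕ)

theorem measurable_labelPowers (i : Fin 3) : Measurable (labelPowers d i) :=
  measurable_snd.pow_const _

theorem integrable_labelPowers {P : Measure (Example d ℝ)} [IsFiniteMeasure P]
    (hP : MemLp (fun z => z.2) 2 P) (i : Fin 3) : Integrable (labelPowers d i) P := by
  fin_cases i
  · exact (integrable_const (1 : ℝ)).congr (.of_forall fun z => (pow_zero z.2).symm)
  · exact (hP.integrable one_le_two).congr (.of_forall fun z => (pow_one z.2).symm)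
  · exact hP.integrable_sq

theorem weighted_labelVariance_eq (Q : Measure (Example d ℝ)) [IsFiniteMeasure Q]
    (hQ : ∀ i, Integrable (labelPowers d i) Q) (A : Set (Example d ℝ)) :
    weighted labelVariance Q A = ∫ z in A, labelPowers d 2 z ∂Q
      - (∫ z in A, labelPowers d 1 z ∂Q) ^ 2 / ∫ z in A, labelPowers d 0 z ∂Q := by
  have h0 : ∫ z in A, labelPowers d 0 z ∂Q = Q.real A := by simp [labelPowers]
  rw [h0]
  rcases eq_or_ne (Q.real A) 0 with hA | hA
  · have hA' : Q A = 0 := (measureReal_eq_zero_iff).1 hA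
    simp [weighted, hA, Measure.restrict_eq_zero.2 hA']
  · have hA' : Q A ≠ 0 := fun h => hA (by simp [Measure.real, h])
    have hint (f : Example d ℝ → ℝ) : ∫ z, f z ∂ProbabilityTheory.cond Q A
        = (Q.real A)⁻¹ * ∫ z in A, f z ∂Q := by
      rw [ProbabilityTheory.cond, integral_smul_measure]
      simp [Measure.real]
    have : IsProbabilityMeasure (ProbabilityTheory.cond Q A) := cond_isProbabilityMeasure hA'
    have hL : MemLp (fun z : Example d ℝ => z.2) 2 (ProbabilityTheory.cond Q A) := by
      rw [memLp_two_iff_integrable_sq measurable_snd.aestronglyMeasurable]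
      exact ((hQ 2).integrableOn (s := A)).smul_measure (by simp [hA'])
    rw [weighted, labelVariance, variance_eq_sub hL]
    have e2 : ∫ z, ((fun z : Example d ℝ => z.2) ^ 2) z ∂ProbabilityTheory.cond Q A
      = (Q.real A)⁻¹ * ∫ z in A, labelPowers d 2 z ∂Q := hint _
    have e1 : ∫ z : Example d ℝ, z.2 ∂ProbabilityTheory.cond Q A
      = (Q.real A)⁻¹ * ∫ z in A, labelPowers d 1 z ∂Q := by
        rw [hint]; simp [labelPowers]
    rw [e2, e1]
    field_simp

/-- Continuity of `(q, m) ↦ m² / q` on the moments `(q, m, v)` with small second moment `v` near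
`q = 0`. -/
theorem exists_abs_sq_div_sub_le (B η ε : ℝ) (hη : 0 < η) (hε : 0 < ε) :
    ∃ δ : ℝ, 0 < δ ∧ ∀ q m v q' m' v' : ℝ, q ≤ 1 → |m| ≤ B → (q < η → v ≤ ε / 4) →
      m ^ 2 / q ≤ v → m' ^ 2 / q' ≤ v' → 0 ≤ q → 0 ≤ q' →
      |q' - q| ≤ δ → |m' - m| ≤ δ → |v' - v| ≤ δ →
      |(v' - m' ^ 2 / q') - (v - m ^ 2 / q)| ≤ ε := by
  set C : Set (ℝ × ℝ) := Set.Icc (η / 2) 2 ×ˢ Set.Icc (-(B + 1)) (B + 1)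
  have hcont : ContinuousOn (fun p : ℝ × ℝ => p.2 ^ 2 / p.1) C := by
    refine ContinuousOn.div (by fun_prop) (by fun_prop) fun p hp => ?_
    have := hp.1.1
    linarith
  have huc := (isCompact_Icc.prod isCompact_Icc).uniformContinuousOn_of_continuous hcont
  obtain ⟨δ₀, hδ₀, h⟩ := Metric.uniformContinuousOn_iff.1 huc (ε / 2) (half_pos hε)
  obtain ⟨δ, hδ, h1, h2, h3, h4⟩ : ∃ δ : ℝ, 0 < δ ∧ δ < δ₀ ∧ δ ≤ ε / 4 ∧ δ ≤ η / 2 ∧ δ ≤ 1 := by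
    refine ⟨min (min (δ₀ / 2) (ε / 4)) (min (η / 2) 1), by positivity, ?_, ?_, ?_, ?_⟩
    · exact ((min_le_left _ _).trans (min_le_left _ _)).trans_lt (half_lt_self hδ₀)
    · exact (min_le_left _ _).trans (min_le_right _ _)
    · exact (min_le_right _ _).trans (min_le_left _ _)
    · exact (min_le_right _ _).trans (min_le_right _ _)
  refine ⟨δ, hδ, fun q m v q' m' v' hq1 hmB hsmall hcs hcs' hq hq' dq dm dv => ?_⟩
  have dq' := abs_le.1 dq
  have dm' := abs_le.1 dm
  have dv' := abs_le.1 dv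
  have hm' := abs_le.1 hmB
  have p0 : 0 ≤ m ^ 2 / q := by positivity
  have p0' : 0 ≤ m' ^ 2 / q' := by positivity
  rcases lt_or_ge q η with hlt | hge
  -- Both values lie between `0` and the second moment, and `v' ≤ v + δ ≤ ε / 2`.
  · have := hsmall hlt
    exact abs_le.2 ⟨by linarith [dv'.1, dv'.2], by linarith [dv'.1, dv'.2]⟩
  -- Away from `q = 0` both points lie in the compact set `C`, since `δ ≤ η / 2` and `δ ≤ 1`.
  · have hd := h (q', m') ⟨⟨by linarith [dq'.1], by linarith [dq'.2]⟩,
      ⟨by linarith [dm'.1, hm'.1], by linarith [dm'.2, hm'.2]⟩⟩ (q, m)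
      ⟨⟨by linarith, by linarith⟩, ⟨by linarith [hm'.1], by linarith [hm'.2]⟩⟩ (by
        rw [Prod.dist_eq, max_lt_iff, Real.dist_eq, Real.dist_eq]
        exact ⟨dq.trans_lt h1, dm.trans_lt h1⟩)
    rw [Real.dist_eq] at hd
    have hd' := abs_lt.1 hd
    simp only at hd'
    exact abs_le.2 ⟨by linarith [dv'.1, hd'.2], by linarith [dv'.2, hd'.1]⟩

/-- The term `m² / q` is singular at `q = 0`. There it is dominated by the second moment
(nonnegativity of the variance), which under `P` is small on all events of small mass by absolute
continuity of the integral. -/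
theorem continuouslyDetermined_labelVariance {I : Fin d → Set ℝ}
    (P : Measure (Example d ℝ)) [IsProbabilityMeasure P] (hP : MemLp (fun z => z.2) 2 P) :
    ContinuouslyDetermined labelVariance (labelPowers d) I P := by
  intro ε hε
  have hPi := integrable_labelPowers hP
  obtain ⟨η, hη, hsmall⟩ : ∃ η : ℝ, 0 < η ∧ ∀ A : Set (Example d ℝ), P.real A < η →
      ∫ z in A, labelPowers d 2 z ∂P ≤ ε / 4 := by
    have hlim := (hPi 2).tendsto_setIntegral_nhds_zero
      (l := comap P (𝓝 0)) (s := id) tendsto_comap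
    have hev := hlim.eventually (ge_mem_nhds (by positivity : (0 : ℝ) < ε / 4))
    rw [eventually_comap] at hev
    obtain ⟨η, hη, h⟩ := (ENNReal.nhds_zero_basis.eventually_iff).1 hev
    obtain ⟨c, hc0, hc⟩ := ENNReal.lt_iff_exists_nnreal_btwn.1 hη
    refine ⟨c, by exact_mod_cast hc0, fun A hA => h (x := P A) ?_ A rfl⟩
    refine lt_trans ?_ hc
    rw [← ENNReal.ofReal_coe_nnreal]
    exact (ENNReal.lt_ofReal_iff_toReal_lt (measure_ne_top P A)).2 hA
  obtain ⟨δ, hδ, h⟩ := exists_abs_sq_div_sub_le (∫ z, |labelPowers d 1 z| ∂P) η ε hη hε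
  refine ⟨δ, hδ, fun Q hQ hQi hc A hA => ?_⟩
  have : IsFiniteMeasure Q := ⟨hQ.trans_lt ENNReal.one_lt_top⟩
  have hmass (μ : Measure (Example d ℝ)) : ∫ z in A, labelPowers d 0 z ∂μ = μ.real A := by
    simp [labelPowers]
  have hcs (μ : Measure (Example d ℝ)) [IsFiniteMeasure μ]
      (hμ : ∀ i, Integrable (labelPowers d i) μ) :
      (∫ z in A, labelPowers d 1 z ∂μ) ^ 2 / ∫ z in A, labelPowers d 0 z ∂μ
        ≤ ∫ z in A, labelPowers d 2 z ∂μ := by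
    rw [← sub_nonneg, ← weighted_labelVariance_eq μ hμ A]
    exact weighted_labelVariance_nonneg μ A
  rw [weighted_labelVariance_eq Q hQi, weighted_labelVariance_eq P hPi]
  refine h _ _ _ _ _ _ ?_ ?_ ?_ (hcs P hPi) (hcs Q hQi) ?_ ?_ (hc 0 A hA) (hc 1 A hA) (hc 2 A hA)
  · rw [hmass]; exact measureReal_le_one
  · exact (abs_integral_le_integral_abs).trans
      (setIntegral_le_integral (hPi 1).abs (.of_forall fun _ => abs_nonneg _))
  · rw [hmass]; exact hsmall A
  · rw [hmass]; exact measureReal_nonneg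
  · rw [hmass]; exact measureReal_nonneg

end Impurities

/-! ### Deterministic counting in the two voting rounds -/

section Voting

/-- Pigeonhole: were `σ 0` left out, `T` would have `k` elements, and these together with `σ 0`
would be `k + 1` attributes of rank below `k`. -/
theorem mem_of_isTopSet_univ {d : ℕ} [NeZero d] {g : Fin d → ℝ} {σ : Equiv.Perm (Fin d)} {k : ℕ}
    {T : Finset (Fin d)} (hT : IsTopSet Finset.univ g k T)
    (hg : ∀ r : Fin d, k ≤ r → g (σ r) < g (σ 0)) : σ 0 ∈ T := by
  by_contra h0
  obtain ⟨-, hcard, htop⟩ := hT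
  have hcard' := Finset.card_insert_of_notMem h0
  rw [hcard, Finset.card_univ, Fintype.card_fin] at hcard'
  have hle := Finset.card_le_univ (insert (σ 0) T)
  rw [Fintype.card_fin] at hle
  have hlt : ∀ i ∈ insert (σ 0) T, (σ.symm i : ℕ) < k := by
    intro i hi
    by_contra hk
    have := hg (σ.symm i) (not_lt.1 hk)
    rw [Equiv.apply_symm_apply] at this
    rcases Finset.mem_insert.1 hi with rfl | hi
    · exact lt_irrefl _ this
    · exact absurd (htop i hi _ (Finset.mem_univ _) h0) (not_le.2 this)
  have hle' := Finset.card_le_card_of_injOn (t := Finset.range k) (fun i => (σ.symm i : ℕ))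
    (fun i hi => Finset.mem_coe.2 (Finset.mem_range.2 (hlt i hi)))
    (fun i _ j _ hij => σ.symm.injective (Fin.val_injective hij))
  rw [Finset.card_range] at hle'
  omega

/-- An attribute that a majority of the machines select is selected globally. -/
theorem IsVoting.mem_of_majority {d M n k : ℕ} {Y : Type} [MeasurableSpace Y]
    {Φ : Measure (Example d Y) → ℝ} {I : Fin d → Set ℝ} {s : Fin M → Fin n → Example d Y}
    {T : Fin M → Finset (Fin d)} {G : Finset (Fin d)} (h : IsVoting Φ I k s T G) {a : Fin d}
    (ha : M < 2 * (Finset.univ.filter fun m => a ∈ T m).card) : a ∈ G := by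
  by_contra haG
  obtain ⟨hsub, hcard, htop⟩ := h.globalTop
  set v : Fin d → ℕ := fun j => (Finset.univ.filter fun m => j ∈ T m).card
  have hv : 0 < v a := by change M < 2 * v a at ha; omega
  obtain ⟨m, hm⟩ := Finset.card_pos.1 hv
  have haA : a ∈ Finset.univ.biUnion T :=
    Finset.mem_biUnion.2 ⟨m, Finset.mem_univ _, (Finset.mem_filter.1 hm).2⟩
  have hlt := Finset.card_lt_card (Finset.ssubset_iff_subset_ne.2
    ⟨hsub, fun hG => haG (hG ▸ haA)⟩)
  have hG : G.card = 2 * k := by omega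
  -- If `a` is left out, it and the `2k` members of `G` all have at least `v a` votes, so `(2k + 1)
  -- * v a ≤ M * k ≤ 2k * v a`, which is impossible for `v a > 0`.
  have htotal : ∑ j, v j ≤ M * k := by
    have : ∑ j, v j = ∑ m, (T m).card := by
      simp only [v, Finset.card_filter]
      rw [Finset.sum_comm]
      simp
    rw [this]
    calc ∑ m, (T m).card ≤ ∑ _m : Fin M, k :=
          Finset.sum_le_sum fun m _ => (h.localTop m).2.1.le.trans (min_le_left _ _)
      _ = M * k := by simp
  have hlower : (2 * k + 1) * v a ≤ ∑ j, v j := by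
    calc (2 * k + 1) * v a = ∑ _j ∈ insert a G, v a := by
          rw [Finset.sum_const, Finset.card_insert_of_notMem haG, hG, smul_eq_mul]
      _ ≤ ∑ j ∈ insert a G, v j := Finset.sum_le_sum fun j hj => by
          rcases Finset.mem_insert.1 hj with rfl | hj
          · exact le_rfl
          · exact htop j hj a haA haG
      _ ≤ ∑ j, v j := Finset.sum_le_sum_of_subset (Finset.subset_univ _)
  change M < 2 * v a at ha
  nlinarith [Nat.mul_le_mul_right k ha.le]

end Voting

/-! ### Binomial tails and stochastic domination -/

section BinomialTail

/-- The probability that a binomial variable with `M` trials of failure probability `S` is at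
least `t`. -/
noncomputable def binomialTail (M t : ℕ) (S : ℝ) : ℝ :=
  ∑ m ∈ Finset.range (M + 1),
    if t ≤ m then (M.choose m : ℝ) * (1 - S) ^ m * S ^ (M - m) else 0

theorem majorityTail_eq_binomialTail (M : ℕ) (S : ℝ) :
    majorityTail M S = binomialTail M (M / 2 + 1) S := by
  rw [majorityTail, binomialTail, ← Finset.sum_filter]
  congr 1
  ext m
  simp only [Finset.mem_Icc, Finset.mem_filter, Finset.mem_range]
  omega

theorem sum_binomial_eq_one (M : ℕ) (S : ℝ) :
    ∑ m ∈ Finset.range (M + 1), (M.choose m : ℝ) * (1 - S) ^ m * S ^ (M - m) = 1 := by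
  have h := add_pow (1 - S) S M
  rw [sub_add_cancel, one_pow] at h
  exact (Finset.sum_congr rfl fun m _ => by ring).trans h.symm

theorem binomialTail_zero_right (M : ℕ) (S : ℝ) : binomialTail M 0 S = 1 := by
  simp [binomialTail, sum_binomial_eq_one]

theorem binomialTail_zero_left (t : ℕ) (S : ℝ) : binomialTail 0 (t + 1) S = 0 := by
  simp [binomialTail]

theorem binomialTail_succ_succ (M t : ℕ) (S : ℝ) :
    binomialTail (M + 1) (t + 1) S
      = (1 - S) * binomialTail M t S + S * binomialTail M (t + 1) S := by
  have hpascal (m : ℕ) :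
      ((M + 1).choose (m + 1) : ℝ) * (1 - S) ^ (m + 1) * S ^ (M + 1 - (m + 1))
        = (1 - S) * ((M.choose m : ℝ) * (1 - S) ^ m * S ^ (M - m))
          + S * ((M.choose (m + 1) : ℝ) * (1 - S) ^ (m + 1) * S ^ (M - (m + 1))) := by
    rw [Nat.choose_succ_succ, Nat.add_sub_add_right]
    push_cast
    rcases lt_or_ge m M with hm | hm
    · have : M - m = M - (m + 1) + 1 := by omega
      rw [this]
      ring
    · rw [Nat.choose_eq_zero_of_lt (Nat.lt_succ_of_le hm)]
      push_cast
      ring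
  -- Shifts the index: the added top term has `M.choose (M + 1) = 0`, and the bottom one fails `t +
  -- 1 ≤ 0`.
  have hext : binomialTail M (t + 1) S = ∑ m ∈ Finset.range (M + 1),
      if t ≤ m then (M.choose (m + 1) : ℝ) * (1 - S) ^ (m + 1) * S ^ (M - (m + 1)) else 0 := by
    have h := Finset.sum_range_succ (fun m =>
      if t + 1 ≤ m then (M.choose m : ℝ) * (1 - S) ^ m * S ^ (M - m) else 0) (M + 1)
    rw [Finset.sum_range_succ'] at h
    simp only [Nat.choose_succ_self, Nat.cast_zero, zero_mul, ite_self, add_zero,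
      add_le_add_iff_right, Nat.le_zero_eq, Nat.add_eq_zero_iff, one_ne_zero, and_false,
      if_false] at h
    rw [binomialTail, h]
  rw [hext, binomialTail, Finset.sum_range_succ', binomialTail, Finset.mul_sum, Finset.mul_sum,
    ← Finset.sum_add_distrib]
  simp only [Nat.le_zero_eq, Nat.add_eq_zero_iff, one_ne_zero, and_false, if_false, add_zero,
    add_le_add_iff_right]
  refine Finset.sum_congr rfl fun m _ => ?_
  split_ifs
  · exact hpascal m
  · simp

/-- A majority needs at least one success, and `S ^ M` is the weight of no success at all. -/
theorem majorityTail_le_one_sub_pow {M : ℕ} {S : ℝ} (h0 : 0 ≤ S) (h1 : S ≤ 1) :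
    majorityTail M S ≤ 1 - S ^ M := by
  have hsum := sum_binomial_eq_one M S
  rw [Finset.sum_range_succ'] at hsum
  rw [majorityTail_eq_binomialTail, binomialTail, Finset.sum_range_succ']
  have hle : ∑ m ∈ Finset.range M, (if M / 2 + 1 ≤ m + 1 then
        (M.choose (m + 1) : ℝ) * (1 - S) ^ (m + 1) * S ^ (M - (m + 1)) else 0)
      ≤ ∑ m ∈ Finset.range M,
        (M.choose (m + 1) : ℝ) * (1 - S) ^ (m + 1) * S ^ (M - (m + 1)) := by
    refine Finset.sum_le_sum fun m _ => ?_
    have := sub_nonneg.2 h1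
    split_ifs
    · exact le_rfl
    · positivity
  simp only [Nat.choose_zero_right, Nat.cast_one, pow_zero, mul_one, one_mul, Nat.sub_zero]
    at hsum
  simp only [Nat.le_zero_eq, Nat.add_eq_zero_iff, one_ne_zero, and_false, if_false, add_zero]
  linarith

theorem measurableSet_le_count {Ω : Type} [MeasurableSpace Ω] {B : Set Ω} (hB : MeasurableSet B)
    [DecidablePred (· ∈ B)] (M t : ℕ) :
    MeasurableSet {x : Fin M → Ω | t ≤ (Finset.univ.filter fun m => x m ∉ B).card} := by
  simp only [Finset.card_filter]
  refine measurableSet_le measurable_const (Finset.measurable_fun_sum _ fun m _ => ?_)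
  exact Measurable.ite (measurable_pi_apply (X := fun _ : Fin M => Ω) m hB.compl)
    measurable_const measurable_const

/-- Among independent trials with failure probability at most `S`, the number of successes
dominates a binomial variable. -/
theorem binomialTail_le_measureReal_pi {Ω : Type} [MeasurableSpace Ω] (μ : Measure Ω)
    [IsProbabilityMeasure μ] {B : Set Ω} (hB : MeasurableSet B) [DecidablePred (· ∈ B)] {S : ℝ}
    (hBS : μ.real B ≤ S) (hS : S ≤ 1) (M t : ℕ) :
    binomialTail M t S ≤ (Measure.pi fun _ : Fin M => μ).real
      {x | t ≤ (Finset.univ.filter fun m => x m ∉ B).card} := by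
  induction M generalizing t with
  | zero =>
    cases t with
    | zero => simp [binomialTail_zero_right]
    | succ t => rw [binomialTail_zero_left]; exact measureReal_nonneg
  | succ M ih =>
    cases t with
    | zero => simp [binomialTail_zero_right]
    | succ t =>
      set E : ℕ → Set (Fin M → Ω) := fun t =>
        {x | t ≤ (Finset.univ.filter fun m => x m ∉ B).card} with hE
      have hEm (t : ℕ) : MeasurableSet (E t) := measurableSet_le_count hB M t
      have hpre : {x : Fin (M + 1) → Ω | t + 1 ≤ (Finset.univ.filter fun m => x m ∉ B).card}
          = MeasurableEquiv.piFinSuccAbove (fun _ => Ω) 0 ⁻¹' (Bᶜ ×ˢ E t ∪ B ×ˢ E (t + 1)) := by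
        ext x
        have htail : (MeasurableEquiv.piFinSuccAbove (fun _ => Ω) 0 x)
            = (x 0, fun m : Fin M => x m.succ) := rfl
        rw [Set.mem_preimage, htail, Set.mem_ofPred_eq, Fin.card_filter_univ_succ]
        simp only [Set.mem_union, Set.mem_prod, hE, Set.mem_ofPred_eq, Set.mem_compl_iff]
        by_cases hx : x 0 ∈ B
        · rw [if_neg (not_not.2 hx)]
          simp only [hx, not_true_eq_false, false_and, true_and, false_or]
        · rw [if_pos hx, Nat.add_le_add_iff_right]
          simp only [hx, not_false_eq_true, false_and, true_and, or_false]
      have hdisj : Disjoint (Bᶜ ×ˢ E t) (B ×ˢ E (t + 1)) :=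
        Set.disjoint_left.2 fun x h1 h2 => h1.1 h2.1
      have hmeas : MeasurableSet (Bᶜ ×ˢ E t ∪ B ×ˢ E (t + 1)) :=
        (hB.compl.prod (hEm _)).union (hB.prod (hEm _))
      have hvalue : (Measure.pi fun _ : Fin (M + 1) => μ).real
          {x | t + 1 ≤ (Finset.univ.filter fun m => x m ∉ B).card}
          = (1 - μ.real B) * (Measure.pi fun _ : Fin M => μ).real (E t)
            + μ.real B * (Measure.pi fun _ : Fin M => μ).real (E (t + 1)) := by
        rw [hpre, (measurePreserving_piFinSuccAbove (fun _ => μ) 0).measureReal_preimage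
          hmeas.nullMeasurableSet, measureReal_union hdisj (hB.prod (hEm _)),
          measureReal_prod_prod, measureReal_prod_prod, probReal_compl_eq_one_sub hB]
      have hmono : (Measure.pi fun _ : Fin M => μ).real (E (t + 1))
          ≤ (Measure.pi fun _ : Fin M => μ).real (E t) :=
        measureReal_mono fun x hx => (Nat.le_succ t).trans hx
      have hS0 : 0 ≤ S := measureReal_nonneg.trans hBS
      rw [hvalue, binomialTail_succ_succ]
      -- Since `E (t + 1)` is no likelier than `E t`, raising the weight of failure from `μ.real B`
      -- to `S` only lowers the mixture.
      nlinarith [mul_le_mul_of_nonneg_left (ih t) (sub_nonneg.2 hS),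
        mul_le_mul_of_nonneg_left (ih (t + 1)) hS0,
        mul_nonneg (sub_nonneg.2 hBS) (sub_nonneg.2 hmono)]

end BinomialTail

/-! ### Consequences of `S ≤ 1` -/

section FailureSum

variable {d : ℕ} {α : Fin d → ℕ → ℝ} {c l : Fin d → ℝ} {n k : ℕ}

theorem failureSum_nonneg (hα : ∀ r n, 0 ≤ α r n) : 0 ≤ failureSum α c l n k :=
  Finset.sum_nonneg fun r _ => add_nonneg (hα r n) (by positivity)

theorem term_le_failureSum (hα : ∀ r n, 0 ≤ α r n) {r : Fin d} (hr : k ≤ r) :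
    α r n + 4 * Real.exp (-(c r * n * (l r) ^ 2)) ≤ failureSum α c l n k :=
  Finset.single_le_sum (f := fun r => α r n + 4 * Real.exp (-(c r * n * (l r) ^ 2)))
    (fun r _ => add_nonneg (hα r n) (by positivity)) (Finset.mem_filter.2 ⟨Finset.mem_univ _, hr⟩)

theorem le_failureSum (hα : ∀ r n, 0 ≤ α r n) {r : Fin d} (hr : k ≤ r) :
    α r n ≤ failureSum α c l n k :=
  (le_add_of_nonneg_right (by positivity)).trans (term_le_failureSum hα hr)

theorem ne_zero_of_failureSum_le_one (hα : ∀ r n, 0 ≤ α r n) (h : failureSum α c l n k ≤ 1)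
    {r : Fin d} (hr : k ≤ r) : l r ≠ 0 := by
  intro hl
  have h1 := (term_le_failureSum (c := c) (l := l) (n := n) hα hr).trans h
  simp only [hl, ne_eq, OfNat.ofNat_ne_zero, not_false_eq_true, zero_pow, mul_zero, neg_zero,
    Real.exp_zero, mul_one] at h1
  linarith [hα r n]

theorem lt_of_failureSum_le_one [NeZero d] {g : Fin d → ℝ} {σ : Equiv.Perm (Fin d)}
    (hσ : Antitone fun r => g (σ r)) (hα : ∀ r n, 0 ≤ α r n)
    (h : failureSum α c (halfGap g σ) n k ≤ 1) {r : Fin d} (hr : k ≤ r) :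
    g (σ r) < g (σ 0) := by
  refine lt_of_le_of_ne (hσ (Fin.zero_le r)) fun heq => ?_
  exact ne_zero_of_failureSum_le_one hα h hr (by simp [halfGap, heq])

end FailureSum

/-! ### Probability bounds for voting and output -/

section Guarantees

variable {d : ℕ} [NeZero d] {Y : Type} [MeasurableSpace Y] {Φ : Measure (Example d Y) → ℝ}
  {I : Fin d → Set ℝ} {P : Measure (Example d Y)} [IsProbabilityMeasure P]
  {σ : Equiv.Perm (Fin d)} {C : Measure (Example d Y) → Prop}

theorem exists_voted_bound (hσ : Antitone fun r => bestGain Φ I P (σ r))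
    (hlocal : ∀ (n : ℕ) (s : Fin n → Example d Y), C (empirical s) →
      RanksBelow Φ I P (σ 0) (empirical s))
    (hlim : Tendsto (fun n => sampleLaw P n {s | ¬ C (empirical s)}) atTop (𝓝 0)) :
    ∃ (α : Fin d → ℕ → ℝ) (c : Fin d → ℝ),
      (∀ r n, 0 ≤ α r n) ∧ (∀ r, Tendsto (α r) atTop (𝓝 0)) ∧ (∀ r, 0 < c r) ∧
      ∀ M n k : ℕ, failureSum α c (halfGap (bestGain Φ I P) σ) n k ≤ 1 →
        majorityTail M (failureSum α c (halfGap (bestGain Φ I P) σ) n k)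
          ≤ (dataLaw P M n).real (votedEvent Φ I M n k (σ 0)) := by
  classical
  have hα (r : Fin d) (n : ℕ) : 0 ≤ (sampleLaw P n).real {s | ¬ C (empirical s)} :=
    measureReal_nonneg
  refine ⟨fun _ n => (sampleLaw P n).real {s | ¬ C (empirical s)}, fun _ => 1, hα,
    fun _ => (ENNReal.tendsto_toReal ENNReal.zero_ne_top).comp hlim, fun _ => one_pos,
    fun M n k hS => ?_⟩
  set S := failureSum _ _ _ n k with hSdef
  -- A measurable hull, as the bad samples need not form a measurable set. For `k ≥ d` the sum `S`
  -- is empty, hence `0`, so failure must be impossible; indeed every machine then selects all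
  -- attributes.
  set B : Set (Fin n → Example d Y) :=
    if k < d then toMeasurable (sampleLaw P n) {s | ¬ C (empirical s)} else ∅ with hBdef
  have hB : MeasurableSet B := by
    rw [hBdef]
    split_ifs
    · exact measurableSet_toMeasurable _ _
    · exact .empty
  have hBS : (sampleLaw P n).real B ≤ S := by
    rw [hBdef]
    split_ifs with hk
    · rw [Measure.real, measure_toMeasurable]
      exact le_failureSum (r := ⟨k, hk⟩) hα le_rfl
    · simpa using failureSum_nonneg hα
  rw [majorityTail_eq_binomialTail]
  refine (binomialTail_le_measureReal_pi (sampleLaw P n) hB hBS hS M _).trans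
    (measureReal_mono (μ := Measure.pi fun _ : Fin M => sampleLaw P n) ?_)
  intro s hs T G hv
  refine hv.mem_of_majority ?_
  have hsub : (Finset.univ.filter fun m => s m ∉ B) ⊆ Finset.univ.filter fun m => σ 0 ∈ T m := by
    intro m hm
    refine Finset.mem_filter.2 ⟨Finset.mem_univ _, mem_of_isTopSet_univ (hv.localTop m) ?_⟩
    intro r hr
    have hmB := (Finset.mem_filter.1 hm).2
    rw [hBdef, if_pos (hr.trans_lt r.2)] at hmB
    exact hlocal n _ (not_not.1 fun h => hmB (subset_toMeasurable _ _ h)) _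
      (lt_of_failureSum_le_one hσ hα hS hr)
  have hs' : M / 2 + 1 ≤ (Finset.univ.filter fun m => s m ∉ B).card := hs
  have := hs'.trans (Finset.card_le_card hsub)
  omega

theorem exists_output_bound (hσ : Antitone fun r => bestGain Φ I P (σ r))
    (hlocal : ∀ (n : ℕ) (s : Fin n → Example d Y), C (empirical s) →
      RanksBelow Φ I P (σ 0) (empirical s))
    (hmerged : ∀ (M n : ℕ) (s : Fin M → Fin n → Example d Y), 0 < M →
      (∀ m, C (empirical (s m))) →
      RanksBelow Φ I P (σ 0) (empirical fun p : Fin M × Fin n => s p.1 p.2))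
    (hlim : Tendsto (fun n => sampleLaw P n {s | ¬ C (empirical s)}) atTop (𝓝 0)) (M : ℕ) :
    ∃ (α : Fin d → ℕ → ℝ) (c : Fin d → ℝ),
      (∀ r n, 0 ≤ α r n) ∧ (∀ r, Tendsto (α r) atTop (𝓝 0)) ∧ (∀ r, 0 < c r) ∧
      ∀ n k : ℕ, k < d → failureSum α c (halfGap (bestGain Φ I P) σ) n k ≤ 1 →
        majorityTail M (failureSum α c (halfGap (bestGain Φ I P) σ) n k)
          ≤ (dataLaw P M n).real (outputEvent Φ I P M n k (σ 0)) := by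
  rcases Nat.eq_zero_or_pos M with rfl | hM
  · refine ⟨fun _ _ => 0, fun _ => 1, fun _ _ => le_rfl, fun _ => tendsto_const_nhds,
      fun _ => one_pos, fun n k _ _ => ?_⟩
    simp [majorityTail]
  set q : ℕ → ℝ := fun n => (sampleLaw P n).real {s | ¬ C (empirical s)} with hq
  have hq0 (n : ℕ) : 0 ≤ q n := measureReal_nonneg
  have hqlim : Tendsto q atTop (𝓝 0) := (ENNReal.tendsto_toReal ENNReal.zero_ne_top).comp hlim
  have hα (r : Fin d) (n : ℕ) : 0 ≤ (M * q n) ^ ((M : ℝ)⁻¹) :=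
    Real.rpow_nonneg (mul_nonneg (Nat.cast_nonneg M) (hq0 n)) _
  have hM' : (0 : ℝ) < (M : ℝ)⁻¹ := by positivity
  refine ⟨fun _ n => (M * q n) ^ ((M : ℝ)⁻¹), fun _ => 1, hα, fun _ => ?_, fun _ => one_pos,
    fun n k hk hS => ?_⟩
  · have := (hqlim.const_mul (M : ℝ)).rpow_const (p := (M : ℝ)⁻¹) (.inr hM'.le)
    rwa [mul_zero, Real.zero_rpow hM'.ne'] at this
  set S := failureSum _ _ _ n k with hSdef
  -- Here `k < d` is needed: some term of `S` must contain `α`.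
  have hSM : M * q n ≤ S ^ M := by
    have hle : (M * q n) ^ ((M : ℝ)⁻¹) ≤ S := le_failureSum (r := ⟨k, hk⟩) hα le_rfl
    have := pow_le_pow_left₀ (hα ⟨k, hk⟩ n) hle M
    rwa [Real.rpow_inv_natCast_pow (mul_nonneg (Nat.cast_nonneg M) (hq0 n)) hM.ne'] at this
  set B : Set (Fin n → Example d Y) := toMeasurable (sampleLaw P n) {s | ¬ C (empirical s)}
  have hBq : (sampleLaw P n).real B = q n := by rw [Measure.real, measure_toMeasurable]; rfl
  have hall : (Measure.pi fun _ : Fin M => sampleLaw P n).real (Set.univ.pi fun _ => Bᶜ)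
      = (1 - q n) ^ M := by
    rw [measureReal_def, Measure.pi_pi, ENNReal.toReal_prod, Finset.prod_const, Finset.card_univ,
      Fintype.card_fin, ← measureReal_def,
      probReal_compl_eq_one_sub (measurableSet_toMeasurable _ _), hBq]
  -- Bernoulli's inequality: `1 - M * q n ≤ (1 - q n) ^ M`.
  have hbern := one_add_mul_le_pow (a := -q n)
    (by linarith [hBq ▸ (measureReal_le_one : (sampleLaw P n).real B ≤ 1)]) M
  calc majorityTail M S ≤ 1 - S ^ M := majorityTail_le_one_sub_pow (failureSum_nonneg hα) hS
    _ ≤ (1 - q n) ^ M := by rw [← sub_eq_add_neg] at hbern; linarith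
    _ ≤ _ := hall ▸ measureReal_mono (μ := Measure.pi fun _ : Fin M => sampleLaw P n) ?_
  intro s hs T G hv
  have hC (m : Fin M) : C (empirical (s m)) :=
    not_not.1 fun h => hs m (Set.mem_univ _) (subset_toMeasurable _ _ h)
  have hvote (m : Fin M) : σ 0 ∈ T m := mem_of_isTopSet_univ (hv.localTop m) fun r hr =>
    hlocal n _ (hC m) _ (lt_of_failureSum_le_one hσ hα hS hr)
  have hG : σ 0 ∈ G := hv.mem_of_majority (by simp [hvote]; omega)
  refine ⟨hG, fun j hj => ?_⟩
  by_contra hne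
  have hmax : bestGain Φ I P j ≤ bestGain Φ I P (σ 0) := by
    simpa using hσ (Fin.zero_le (σ.symm j))
  exact absurd (hj.2 _ hG) (not_le.2 (hmerged M n s hM hC j (lt_of_le_of_ne hmax hne)))

theorem exists_bounds_of_continuouslyDetermined [MeasurableSingletonClass Y] {κ : Type}
    [Fintype κ] {F : κ → Example d Y → ℝ} (hI : ∀ j, (I j).OrdConnected)
    (hΦ : ∀ Q A, 0 ≤ weighted Φ Q A) (hF : ∀ i, Measurable (F i))
    (hFi : ∀ i, Integrable (F i) P) (hc : ContinuouslyDetermined Φ F I P)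
    (hσ : Antitone fun r => bestGain Φ I P (σ r)) :
    (∃ (α : Fin d → ℕ → ℝ) (c : Fin d → ℝ),
      (∀ r n, 0 ≤ α r n) ∧ (∀ r, Tendsto (α r) atTop (𝓝 0)) ∧ (∀ r, 0 < c r) ∧
      ∀ M n k : ℕ, failureSum α c (halfGap (bestGain Φ I P) σ) n k ≤ 1 →
        majorityTail M (failureSum α c (halfGap (bestGain Φ I P) σ) n k)
          ≤ (dataLaw P M n).real (votedEvent Φ I M n k (σ 0))) ∧
    (∀ M : ℕ, ∃ (α : Fin d → ℕ → ℝ) (c : Fin d → ℝ),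
      (∀ r n, 0 ≤ α r n) ∧ (∀ r, Tendsto (α r) atTop (𝓝 0)) ∧ (∀ r, 0 < c r) ∧
      ∀ n k : ℕ, k < d → failureSum α c (halfGap (bestGain Φ I P) σ) n k ≤ 1 →
        majorityTail M (failureSum α c (halfGap (bestGain Φ I P) σ) n k)
          ≤ (dataLaw P M n).real (outputEvent Φ I P M n k (σ 0))) := by
  obtain ⟨δ, hδ, h⟩ := hc.exists_ranksBelow hΦ (σ 0)
  have hlocal (n : ℕ) (s : Fin n → Example d Y) (hs : NodeClose F I P δ (empirical s)) :
      RanksBelow Φ I P (σ 0) (empirical s) :=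
    h _ (empirical_univ_le_one s) (fun _ => integrable_empirical s _) hs
  have hlim := tendsto_sampleLaw_not_nodeClose hI hF hFi hδ
  exact ⟨exists_voted_bound hσ hlocal hlim, exists_output_bound hσ hlocal
    (fun M n s hM hs => h _ (empirical_univ_le_one _) (fun _ => integrable_empirical _ _)
      (NodeClose.merged hI hM hs)) hlim⟩

end Guarantees

end PVTree

theorem theorem4p1 (d : ℕ) [NeZero d] (I : Fin d → Set ℝ) (hI : ∀ j, (I j).OrdConnected) :
    -- classification
    (∀ (K : ℕ) (P : Measure (Example d (Fin K))) [IsProbabilityMeasure P]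
        (σ : Equiv.Perm (Fin d)), Antitone (fun r => bestGain labelEntropy I P (σ r)) →
      (∃ (α : Fin d → ℕ → ℝ) (c : Fin d → ℝ),
        (∀ r n, 0 ≤ α r n) ∧ (∀ r, Tendsto (α r) atTop (𝓝 0)) ∧ (∀ r, 0 < c r) ∧
        ∀ M n k : ℕ,
          failureSum α c (halfGap (bestGain labelEntropy I P) σ) n k ≤ 1 →
          majorityTail M (failureSum α c (halfGap (bestGain labelEntropy I P) σ) n k)
            ≤ (dataLaw P M n).real (votedEvent labelEntropy I M n k (σ 0))) ∧
      (∀ M : ℕ, ∃ (α : Fin d → ℕ → ℝ) (c : Fin d → ℝ),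
        (∀ r n, 0 ≤ α r n) ∧ (∀ r, Tendsto (α r) atTop (𝓝 0)) ∧ (∀ r, 0 < c r) ∧
        ∀ n k : ℕ, k < d →
          failureSum α c (halfGap (bestGain labelEntropy I P) σ) n k ≤ 1 →
          majorityTail M (failureSum α c (halfGap (bestGain labelEntropy I P) σ) n k)
            ≤ (dataLaw P M n).real (outputEvent labelEntropy I P M n k (σ 0)))) ∧
    -- regression
    (∀ (P : Measure (Example d ℝ)) [IsProbabilityMeasure P], MemLp (fun z => z.2) 2 P →
        ∀ σ : Equiv.Perm (Fin d), Antitone (fun r => bestGain labelVariance I P (σ r)) →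
      (∃ (α : Fin d → ℕ → ℝ) (c : Fin d → ℝ),
        (∀ r n, 0 ≤ α r n) ∧ (∀ r, Tendsto (α r) atTop (𝓝 0)) ∧ (∀ r, 0 < c r) ∧
        ∀ M n k : ℕ,
          failureSum α c (halfGap (bestGain labelVariance I P) σ) n k ≤ 1 →
          majorityTail M (failureSum α c (halfGap (bestGain labelVariance I P) σ) n k)
            ≤ (dataLaw P M n).real (votedEvent labelVariance I M n k (σ 0))) ∧
      (∀ M : ℕ, ∃ (α : Fin d → ℕ → ℝ) (c : Fin d → ℝ),
        (∀ r n, 0 ≤ α r n) ∧ (∀ r, Tendsto (α r) atTop (𝓝 0)) ∧ (∀ r, 0 < c r) ∧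
        ∀ n k : ℕ, k < d →
          failureSum α c (halfGap (bestGain labelVariance I P) σ) n k ≤ 1 →
          majorityTail M (failureSum α c (halfGap (bestGain labelVariance I P) σ) n k)
            ≤ (dataLaw P M n).real (outputEvent labelVariance I P M n k (σ 0)))) := by
  refine ⟨fun K P _ σ hσ => ?_, fun P _ hP σ hσ => ?_⟩
  · exact exists_bounds_of_continuouslyDetermined hI weighted_labelEntropy_nonneg
      measurable_classIndicators (fun i => integrable_classIndicators i P)
      (continuouslyDetermined_labelEntropy hI P) hσ
  · exact exists_bounds_of_continuouslyDetermined hI weighted_labelVariance_nonneg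
      measurable_labelPowers (integrable_labelPowers hP)
      (continuouslyDetermined_labelVariance P hP) hσ
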